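/- Let $n,p\ge 1$ and $d$ be integers, and let $X_{i,j}$ ($1\le i\le n$, $1\le j\le d$) be independent real-valued random variables with $\mathbb{E}|X_{i,j}|^{p+1}<\infty$. Let $Z$ be a standard normal random variable and $\mathbf{Z}$ a standard $d$-dimensional normal random vector. For non-negative integers $k\le p$ put $\epsilon_{i,j,k}=\mathbb{E}X_{i,j}^k-\mathbb{E}Z^k$; let $\mathbf{X}_i=(X_{i,1},\ldots,X_{i,d})^T$ and $\mathbf{W}_n=\frac{1}{\sqrt n}\sum_{i=1}^n\mathbf{X}_i$. Let $C_b^{p+1}(\mathbb{R}^d)$ be the space of bounded functions $h:\mathbb{R}^d\to\mathbb{R}$ that are $p+1$ times differentiable with bounded derivatives of all orders $k\le p+1$, and write $\|g\|=\sup_{\mathbf{w}\in\mathbb{R}^d}|g(\mathbf{w})|$. Then, for all $h\in C_b^{p+1}(\mathbb{R}^d)$, \begin{align*}|\mathbb{E}h(\mathbf{W}_n)-\mathbb{E}h(\mathbf{Z})|&\leq \sum_{i=1}^{n}\sum_{j=1}^d\frac{|\epsilon_{i,j,1}|}{\sqrt{n}}\bigg\|\frac{\partial h}{\partial w_j}\bigg\|+\sum_{i=1}^{n}\sum_{j=1}^d\sum_{k=1}^{p-1}\frac{M_{j,k}}{k!\,n^{(k+1)/2}}\,|k\epsilon_{i,j,k-1}-\epsilon_{i,j,k+1}|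 \\ &\quad +\sum_{i=1}^{n}\sum_{j=1}^d\frac{M_{j,p}}{n^{(p+1)/2}}\bigg(\frac{\mathbb{E}|X_{i,j}|^{p-1}}{(p-1)!}+\frac{\mathbb{E}|X_{i,j}|^{p+1}}{p!}\bigg),\end{align*} where, for $1\le j\le d$ and $1\le k\le p$, \[M_{j,k}=\min\bigg\{\frac{\Gamma(\frac{k+1}{2})}{\sqrt{2}\,\Gamma(\frac{k}{2}+1)}\bigg\|\frac{\partial^{k}h}{\partial w_j^k}\bigg\|,\ \frac{1}{k+1}\bigg\|\frac{\partial^{k+1}h}{\partial w_j^{k+1}}\bigg\|\bigg\}.\] -/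

import Mathlib

open MeasureTheory ProbabilityTheory

noncomputable section

namespace MatchingMoments

/-- `h ∈ C_b^m(ℝ^d)`: `h` is `m` times differentiable, and `h` together with its derivatives
`D^k h`, `1 ≤ k ≤ m`, is bounded (the case `k = 0` of `bounded` is the boundedness of `h`).
Continuity of the top derivative `D^m h` is not required. -/
structure IsCb {d : ℕ} (m : ℕ) (h : EuclideanSpace ℝ (Fin d) → ℝ) : Prop where
  differentiable : ∀ k < m, Differentiable ℝ (iteratedFDeriv ℝ k h)
  bounded : ∀ k ≤ m, ∃ C : ℝ, ∀ w, ‖iteratedFDeriv ℝ k h w‖ ≤ C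

/-- The partial derivative `∂g/∂w_j`. -/
def partialDeriv {d : ℕ} (j : Fin d) (g : EuclideanSpace ℝ (Fin d) → ℝ) :
    EuclideanSpace ℝ (Fin d) → ℝ :=
  fun w => lineDeriv ℝ g w (EuclideanSpace.single j (1 : ℝ))

/-- The iterated partial derivative `∂^k g/∂w_j^k`. -/
def iterPartialDeriv {d : ℕ} (j : Fin d) (k : ℕ) (g : EuclideanSpace ℝ (Fin d) → ℝ) :
    EuclideanSpace ℝ (Fin d) → ℝ :=
  (partialDeriv j)^[k] g

/-- The supremum norm `‖g‖ = sup_w |g(w)|` (of a bounded function). -/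
def supNorm {d : ℕ} (g : EuclideanSpace ℝ (Fin d) → ℝ) : ℝ :=
  ⨆ w, |g w|

/-- The constant `M_{j,k}` attached to the test function `h`. -/
def M {d : ℕ} (h : EuclideanSpace ℝ (Fin d) → ℝ) (j : Fin d) (k : ℕ) : ℝ :=
  min
    (Real.Gamma (((k : ℝ) + 1) / 2) / (Real.sqrt 2 * Real.Gamma ((k : ℝ) / 2 + 1))
      * supNorm (iterPartialDeriv j k h))
    (1 / ((k : ℝ) + 1) * supNorm (iterPartialDeriv j (k + 1) h))

/-- The moment mismatch `E Y^k - E Z^k`, with `Z` standard normal. -/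
def momentMismatch {Ω : Type*} [MeasurableSpace Ω] (P : Measure Ω) (Y : Ω → ℝ) (k : ℕ) : ℝ :=
  (∫ ω, (Y ω) ^ k ∂P) - ∫ z, z ^ k ∂(gaussianReal 0 1)

/-- The standardised sum `W_n = n^{-1/2} ∑_i X_i`, where `X_i = (X_{i,1}, …, X_{i,d})ᵀ`. -/
def standardisedSum {Ω : Type*} {n d : ℕ} (X : Fin n → Fin d → Ω → ℝ) (ω : Ω) :
    EuclideanSpace ℝ (Fin d) :=
  (1 / Real.sqrt n) • ∑ i, WithLp.toLp 2 (fun j => X i j ω)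

end MatchingMoments

end

/-! Gaussian interpolation. Take `W` and `Z` independent, put c = 1/√n, and let φ(θ) = E h(sin θ • W
+ cos θ • Z) for 0 ≤ θ ≤ π/2, so that the quantity to bound is φ(π/2) - φ(0). In φ'(θ), Gaussian
integration by parts turns E[Z_j ∂_j h] into cos θ E[∂_j² h]. Since n c² = 1, this term splits
evenly over i, and the pair (i, j) contributes cos θ (c E[X g(cX)] - c² E[g'(cX)]), where X =
X_{i,j} and g(t) is the mean of ∂_j h at the interpolant with cX replaced by t. Taylor expansion of
g at 0 and the recursion E Z^(k+2) = (k+1) E Z^k express this through moment mismatches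
(`abs_integral_sub_le`).

The constants M_{j,k} come from two bounds on cos θ g^(k) = cos θ sin^k θ E[∂_j^(k+1) h]. One is the
sup norm of ∂_j^(k+1) h. The other undoes the integration by parts: cos θ E[∂_j^(k+1) h] = E[Z_j
∂_j^k h], at most E|Z| = √(2/π) times the sup norm of ∂_j^k h
(`BoundedDirDeriv.abs_mul_integral_le`). The prefactor cos θ is exactly what the second bound
consumes, so nothing blows up at θ = π/2. Integrating the smaller bound over θ gives at most M_{j,k}
(`integral_interpolationFactor_le`). -/

namespace MatchingMoments

/-! ### Gaussian integration by parts and moments -/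

lemma integrable_gaussianReal_iff {f : ℝ → ℝ} :
    Integrable f (gaussianReal 0 1) ↔ Integrable (fun x => f x * gaussianPDFReal 0 1 x) := by
  rw [gaussianReal_of_var_ne_zero 0 one_ne_zero,
    integrable_withDensity_iff_integrable_smul' (measurable_gaussianPDF 0 1)
      (Filter.Eventually.of_forall fun _ => gaussianPDF_lt_top)]
  simp [toReal_gaussianPDF, mul_comm]

lemma integral_gaussianReal_eq (f : ℝ → ℝ) :
    ∫ x, f x ∂(gaussianReal 0 1) = ∫ x, f x * gaussianPDFReal 0 1 x := by
  rw [integral_gaussianReal_eq_integral_smul one_ne_zero]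
  simp [mul_comm]

lemma hasDerivAt_gaussianPDFReal (x : ℝ) :
    HasDerivAt (gaussianPDFReal 0 1) (-(x * gaussianPDFReal 0 1 x)) x := by
  have h : HasDerivAt (fun x : ℝ => -(x - 0) ^ 2 / (2 * ((1 : NNReal) : ℝ))) (-x) x := by
    have := (((hasDerivAt_id x).sub_const 0).pow 2).neg.div_const (2 * ((1 : NNReal) : ℝ))
    refine this.congr_deriv ?_
    simp
    ring
  have := h.exp.const_mul (√(2 * Real.pi * ((1 : NNReal) : ℝ)))⁻¹
  rw [gaussianPDFReal_def]
  refine this.congr_deriv ?_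
  ring

/-- Gaussian integration by parts. -/
lemma integral_mul_gaussianReal {u u' : ℝ → ℝ} (hu : ∀ x, HasDerivAt u (u' x) x)
    (h0 : Integrable u (gaussianReal 0 1)) (h1 : Integrable u' (gaussianReal 0 1))
    (hx : Integrable (fun x => x * u x) (gaussianReal 0 1)) :
    ∫ x, x * u x ∂(gaussianReal 0 1) = ∫ x, u' x ∂(gaussianReal 0 1) := by
  rw [integrable_gaussianReal_iff] at h0 h1 hx
  rw [integral_gaussianReal_eq, integral_gaussianReal_eq]
  have hx' : Integrable (fun x => u x * -(x * gaussianPDFReal 0 1 x)) := by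
    refine hx.neg.congr (Filter.Eventually.of_forall fun x => ?_)
    simp only [Pi.neg_apply]; ring
  have := integral_mul_deriv_eq_deriv_mul_of_integrable (u := u) (u' := u')
    (v := gaussianPDFReal 0 1) (v' := fun x => -(x * gaussianPDFReal 0 1 x))
    (fun x _ => hu x) (fun x _ => hasDerivAt_gaussianPDFReal x) hx' h1 h0
  rw [← neg_inj, ← this, ← integral_neg]
  congr 1 with x
  ring

lemma integrable_pow_gaussianReal (k : ℕ) : Integrable (fun x => x ^ k) (gaussianReal 0 1) := by
  have := (memLp_id_gaussianReal (μ := 0) (v := 1) k).integrable_norm_pow'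
  refine (integrable_norm_iff (by fun_prop)).1 (this.congr ?_)
  simp

/-- Integration by parts with u = x^(k+1). This recursion makes the normal moments cancel in the
combinations kε_{k-1} - ε_{k+1}. -/
lemma integral_pow_add_two_gaussianReal (k : ℕ) :
    ∫ x, x ^ (k + 2) ∂(gaussianReal 0 1) = (k + 1) * ∫ x, x ^ k ∂(gaussianReal 0 1) := by
  have h := integral_mul_gaussianReal (u := fun x => x ^ (k + 1))
    (u' := fun x => (k + 1 : ℝ) * x ^ k) (fun x => by simpa using hasDerivAt_pow (k + 1) x)
    (integrable_pow_gaussianReal _) ((integrable_pow_gaussianReal _).const_mul _)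
    ((integrable_pow_gaussianReal (k + 2)).congr (Filter.Eventually.of_forall fun x => by
      simp only; ring))
  rw [integral_const_mul] at h
  rw [← h]
  congr 1 with x
  ring

lemma integral_abs_gaussianReal : ∫ x, |x| ∂(gaussianReal 0 1) = √(2 / Real.pi) := by
  rw [integral_gaussianReal_eq]
  have h1 : ∀ x : ℝ, |x| * gaussianPDFReal 0 1 x
      = (fun y : ℝ => (√(2 * Real.pi))⁻¹ * (y * Real.exp (-(1 / 2) * y ^ 2))) |x| := by
    intro x
    simp only [gaussianPDFReal_def, sub_zero, NNReal.coe_one, mul_one, sq_abs]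
    ring_nf
  simp_rw [h1]
  rw [integral_comp_abs (f := fun y : ℝ => (√(2 * Real.pi))⁻¹ * (y * Real.exp (-(1 / 2) * y ^ 2))),
    integral_const_mul]
  have h2 := integral_rpow_mul_exp_neg_mul_rpow (p := 2) (q := 1) (b := 1 / 2)
    (by norm_num) (by norm_num) (by norm_num)
  simp only [Real.rpow_one, Real.rpow_two] at h2
  rw [h2]
  norm_num [Real.rpow_neg]
  have hpi := Real.pi_pos
  have h3 : √2 * √2 = 2 := Real.mul_self_sqrt (by norm_num)
  field_simp
  nlinarith

/-! ### Trigonometric integrals behind the constants M_{j,k} -/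

/-- The reduction formula for powers of sine matches Γ(s+1) = sΓ(s) in steps of two, with Γ(1/2) =
√π for the base cases. -/
lemma integral_sin_pow_pi_div_two (k : ℕ) :
    ∫ x in (0 : ℝ)..(Real.pi / 2), Real.sin x ^ k
      = √Real.pi / 2 * (Real.Gamma (((k : ℝ) + 1) / 2) / Real.Gamma ((k : ℝ) / 2 + 1)) := by
  have hpi : √Real.pi * √Real.pi = Real.pi := Real.mul_self_sqrt Real.pi_pos.le
  have hpi0 : √Real.pi ≠ 0 := by positivity
  induction k using Nat.twoStepInduction with
  | zero =>
    simp only [pow_zero, Nat.cast_zero, zero_add, zero_div, Real.Gamma_one,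
      Real.Gamma_one_half_eq, intervalIntegral.integral_const, smul_eq_mul]
    linarith
  | one =>
    have h : Real.Gamma (1 / 2 + 1) = 1 / 2 * √Real.pi := by
      rw [Real.Gamma_add_one (by norm_num), Real.Gamma_one_half_eq]
    simp only [pow_one, integral_sin, Nat.cast_one, h]
    norm_num
    field_simp
  | more k h _ =>
    rw [integral_sin_pow, h]
    have h1 : (((k + 2 : ℕ) : ℝ) + 1) / 2 = ((k : ℝ) + 1) / 2 + 1 := by push_cast; ring
    have h2 : ((k + 2 : ℕ) : ℝ) / 2 + 1 = ((k : ℝ) / 2 + 1) + 1 := by push_cast; ring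
    rw [h1, h2, Real.Gamma_add_one (s := ((k : ℝ) + 1) / 2) (by positivity),
      Real.Gamma_add_one (s := (k : ℝ) / 2 + 1) (by positivity)]
    have h3 : Real.Gamma ((k : ℝ) / 2 + 1) ≠ 0 := (Real.Gamma_pos_of_pos (by positivity)).ne'
    generalize Real.Gamma (((k : ℝ) + 1) / 2) = A
    generalize Real.Gamma ((k : ℝ) / 2 + 1) = B at h3
    simp
    field_simp

lemma sqrt_two_div_pi_mul_integral_sin_pow (k : ℕ) :
    √(2 / Real.pi) * ∫ x in (0 : ℝ)..(Real.pi / 2), Real.sin x ^ k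
      = Real.Gamma (((k : ℝ) + 1) / 2) / (√2 * Real.Gamma ((k : ℝ) / 2 + 1)) := by
  rw [integral_sin_pow_pi_div_two, Real.sqrt_div (by norm_num)]
  have hpi0 : √Real.pi ≠ 0 := by positivity
  have h3 : √2 * √2 = 2 := Real.mul_self_sqrt (by norm_num)
  have h4 : Real.Gamma ((k : ℝ) / 2 + 1) ≠ 0 := (Real.Gamma_pos_of_pos (by positivity)).ne'
  field_simp
  nlinarith

lemma integral_cos_mul_sin_pow (k : ℕ) :
    ∫ x in (0 : ℝ)..(Real.pi / 2), Real.cos x * Real.sin x ^ k = 1 / ((k : ℝ) + 1) := by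
  have h := intervalIntegral.integral_eq_sub_of_hasDerivAt (a := 0) (b := Real.pi / 2)
    (f := fun x => Real.sin x ^ (k + 1) / ((k : ℝ) + 1))
    (f' := fun x => Real.cos x * Real.sin x ^ k)
    (fun x _ => by
      have := ((Real.hasDerivAt_sin x).pow (k + 1)).div_const ((k : ℝ) + 1)
      refine this.congr_deriv ?_
      push_cast
      field_simp)
    (by apply Continuous.intervalIntegrable; fun_prop)
  rw [h]
  simp

/-! ### Taylor remainder and comparison of moments -/

/-- Differentiating the remainder gives the remainder of order one less for the shifted family, so
induction and the mean value inequality suffice. The integral form of the remainder would ask for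
integrability of `G m`; here only a bound is needed. -/
lemma abs_sub_taylor_le_of_nonneg {m : ℕ} {C : ℝ} {G : ℕ → ℝ → ℝ}
    (hG : ∀ k < m, ∀ t, HasDerivAt (G k) (G (k + 1) t) t) (hC : ∀ t, |G m t| ≤ C)
    {t : ℝ} (ht : 0 ≤ t) :
    |G 0 t - ∑ k ∈ Finset.range m, G k 0 * t ^ k / (k.factorial : ℝ)|
      ≤ C * t ^ m / (m.factorial : ℝ) := by
  induction m generalizing G t with
  | zero => simpa using hC t
  | succ m ih =>
    have hd : ∀ s, HasDerivAt
        (fun s => G 0 s - ∑ k ∈ Finset.range (m + 1), G k 0 * s ^ k / (k.factorial : ℝ))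
        (G 1 s - ∑ k ∈ Finset.range m, G (k + 1) 0 * s ^ k / (k.factorial : ℝ)) s := by
      intro s
      simp_rw [Finset.sum_range_succ']
      refine (hG 0 (by omega) s).sub ?_
      simp only [pow_zero]
      refine HasDerivAt.add_const _ (HasDerivAt.fun_sum fun k _ => ?_)
      have := ((hasDerivAt_pow (k + 1) s).const_mul (G (k + 1) 0)).div_const
        (((k + 1).factorial : ℕ) : ℝ)
      refine this.congr_deriv ?_
      rw [Nat.factorial_succ]
      push_cast
      field_simp
    have hB : ∀ s, HasDerivAt (fun s => C * s ^ (m + 1) / ((m + 1).factorial : ℝ))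
        (C * s ^ m / (m.factorial : ℝ)) s := by
      intro s
      have := ((hasDerivAt_pow (m + 1) s).const_mul C).div_const (((m + 1).factorial : ℕ) : ℝ)
      refine this.congr_deriv ?_
      rw [Nat.factorial_succ]
      push_cast
      field_simp
    have := image_norm_le_of_norm_deriv_right_le_deriv_boundary (a := 0) (b := t)
      (f := fun s => G 0 s - ∑ k ∈ Finset.range (m + 1), G k 0 * s ^ k / (k.factorial : ℝ))
      (B := fun s => C * s ^ (m + 1) / ((m + 1).factorial : ℝ))
      (fun s _ => (hd s).continuousAt.continuousWithinAt) (fun s _ => (hd s).hasDerivWithinAt)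
      (by simp [Finset.sum_range_succ']) hB
      (fun s hs => ih (G := fun k => G (k + 1)) (fun k hk => hG (k + 1) (by omega)) hC hs.1)
    exact this ⟨ht, le_rfl⟩

lemma abs_sub_taylor_le {m : ℕ} {C : ℝ} {G : ℕ → ℝ → ℝ}
    (hG : ∀ k < m, ∀ t, HasDerivAt (G k) (G (k + 1) t) t) (hC : ∀ t, |G m t| ≤ C) (t : ℝ) :
    |G 0 t - ∑ k ∈ Finset.range m, G k 0 * t ^ k / (k.factorial : ℝ)|
      ≤ C * |t| ^ m / (m.factorial : ℝ) := by
  rcases le_total 0 t with ht | ht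
  · rw [abs_of_nonneg ht]
    exact abs_sub_taylor_le_of_nonneg hG hC ht
  -- Reflection: the family (-1)^k G_k(-s) is again a chain of derivatives.
  · have := abs_sub_taylor_le_of_nonneg (m := m) (C := C)
      (G := fun k s => (-1) ^ k * G k (-s)) (t := -t)
      (fun k hk s => by
        have := ((hG k hk (-s)).comp s (hasDerivAt_neg s)).const_mul ((-1) ^ k)
        refine this.congr_deriv ?_
        ring)
      (fun s => by simpa [abs_mul] using hC (-s)) (by linarith)
    rw [abs_of_nonpos ht]
    convert this using 3
    · simp
    · refine Finset.sum_congr rfl fun k _ => ?_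
      have h1 : ((-1 : ℝ) ^ k) * (-1) ^ k = 1 := by rw [← mul_pow]; simp
      rw [neg_pow t k, neg_zero]
      linear_combination (-(G k 0 * t ^ k / (k.factorial : ℝ))) * h1

lemma integrable_abs_pow_of_le {ν : Measure ℝ} [IsProbabilityMeasure ν] {m k : ℕ} (hk : k ≤ m)
    (hν : Integrable (fun x => |x| ^ m) ν) : Integrable (fun x => |x| ^ k) ν := by
  refine ((integrable_const (1 : ℝ)).add hν).mono' (by fun_prop)
    (Filter.Eventually.of_forall fun x => ?_)
  simp only [Pi.add_apply, norm_pow, Real.norm_eq_abs, abs_abs]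
  rcases le_total |x| 1 with hx | hx
  · have := pow_le_one₀ (n := k) (abs_nonneg x) hx
    have := pow_nonneg (abs_nonneg x) m
    linarith
  · have := pow_le_pow_right₀ hx hk
    linarith

lemma integrable_pow_of_le {ν : Measure ℝ} [IsProbabilityMeasure ν] {m k : ℕ} (hk : k ≤ m)
    (hν : Integrable (fun x => |x| ^ m) ν) : Integrable (fun x => x ^ k) ν := by
  refine (integrable_norm_iff (by fun_prop)).1 ((integrable_abs_pow_of_le hk hν).congr ?_)
  simp

/-- A Taylor expansion of `E[c X g(c X)]` and `c² E[g'(c X)]`, compared term by term with the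
normal moments. -/
lemma abs_integral_sub_le {ν : Measure ℝ} [IsProbabilityMeasure ν] {q : ℕ}
    (hν : Integrable (fun x => |x| ^ (q + 2)) ν) {c : ℝ} (hc : 0 ≤ c) {G : ℕ → ℝ → ℝ} {m : ℕ → ℝ}
    (hG : ∀ k < q + 1, ∀ t, HasDerivAt (G k) (G (k + 1) t) t)
    (hm : ∀ k ≤ q + 1, ∀ t, |G k t| ≤ m k) :
    |c * (∫ x, x * G 0 (c * x) ∂ν) - c ^ 2 * ∫ x, G 1 (c * x) ∂ν|
      ≤ c * |momentMismatch ν id 1| * m 0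
        + (∑ k ∈ Finset.range q, c ^ (k + 2) / ((k + 1).factorial : ℝ) * m (k + 1)
            * |((k : ℝ) + 1) * momentMismatch ν id k - momentMismatch ν id (k + 2)|)
        + c ^ (q + 2) * m (q + 1) * ((∫ x, |x| ^ q ∂ν) / (q.factorial : ℝ)
            + (∫ x, |x| ^ (q + 2) ∂ν) / ((q + 1).factorial : ℝ)) := by
  have hG0 : Continuous (G 0) :=
    continuous_iff_continuousAt.2 fun t => (hG 0 (by omega) t).continuousAt
  -- For q = 0 the function `G 1` is the top derivative and may be discontinuous, but a derivative
  -- is always measurable.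
  have hG1 : Measurable (G 1) := by
    have : G 1 = deriv (G 0) := funext fun t => (hG 0 (by omega) t).deriv.symm
    rw [this]
    exact measurable_deriv _
  have hpow : ∀ k ≤ q + 2, Integrable (fun x => x ^ k) ν := fun k hk => integrable_pow_of_le hk hν
  have hi1 : Integrable (fun x => G 1 (c * x)) ν :=
    Integrable.of_bound (hG1.comp (measurable_const_mul c)).aestronglyMeasurable (m 1)
      (Filter.Eventually.of_forall fun x => hm 1 (by omega) _)
  have hi0 : Integrable (fun x => x * G 0 (c * x)) ν := by
    have h1 : Integrable (fun x => x) ν := by simpa using hpow 1 (by omega)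
    exact h1.mul_bdd (c := m 0) (by fun_prop)
      (Filter.Eventually.of_forall fun x => hm 0 (by omega) _)
  have hT0 : ∀ k ∈ Finset.range (q + 1),
      Integrable (fun x => G k 0 * c ^ k / (k.factorial : ℝ) * x ^ (k + 1)) ν := fun k hk =>
    (hpow (k + 1) (by simp at hk; omega)).const_mul _
  have hT1 : ∀ k ∈ Finset.range q,
      Integrable (fun x => G (k + 1) 0 * c ^ k / (k.factorial : ℝ) * x ^ k) ν := fun k hk =>
    (hpow k (by simp at hk; omega)).const_mul _
  -- Expanding `G 0` to order q + 1 and `G 1` to order q makes both remainders depend on the same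
  -- bound `m (q + 1)`; the extra factor x raises the first one to the absolute moment q + 2.
  have hR0 : |(∫ x, x * G 0 (c * x) ∂ν)
      - ∑ k ∈ Finset.range (q + 1), G k 0 * c ^ k / (k.factorial : ℝ) * ∫ x, x ^ (k + 1) ∂ν|
      ≤ c ^ (q + 1) * m (q + 1) * ((∫ x, |x| ^ (q + 2) ∂ν) / ((q + 1).factorial : ℝ)) := by
    simp_rw [← integral_const_mul]
    rw [← integral_finsetSum _ hT0, ← integral_sub hi0 (integrable_finsetSum _ hT0),
      ← integral_div, ← integral_const_mul]
    rw [← Real.norm_eq_abs]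
    refine norm_integral_le_of_norm_le ((hν.div_const _).const_mul _)
      (Filter.Eventually.of_forall fun x => ?_)
    have h := abs_sub_taylor_le hG (hm (q + 1) le_rfl) (c * x)
    have h2 : x * G 0 (c * x)
        - ∑ k ∈ Finset.range (q + 1), G k 0 * c ^ k / (k.factorial : ℝ) * x ^ (k + 1)
        = x * (G 0 (c * x)
          - ∑ k ∈ Finset.range (q + 1), G k 0 * (c * x) ^ k / (k.factorial : ℝ)) := by
      rw [mul_sub, Finset.mul_sum]
      congr 1
      refine Finset.sum_congr rfl fun k _ => ?_
      ring
    rw [Real.norm_eq_abs, h2, abs_mul]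
    refine (mul_le_mul_of_nonneg_left h (abs_nonneg x)).trans (le_of_eq ?_)
    rw [abs_mul, abs_of_nonneg hc]
    ring
  have hR1 : |(∫ x, G 1 (c * x) ∂ν)
      - ∑ k ∈ Finset.range q, G (k + 1) 0 * c ^ k / (k.factorial : ℝ) * ∫ x, x ^ k ∂ν|
      ≤ c ^ q * m (q + 1) * ((∫ x, |x| ^ q ∂ν) / (q.factorial : ℝ)) := by
    simp_rw [← integral_const_mul]
    rw [← integral_finsetSum _ hT1, ← integral_sub hi1 (integrable_finsetSum _ hT1),
      ← integral_div, ← integral_const_mul]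
    rw [← Real.norm_eq_abs]
    refine norm_integral_le_of_norm_le
      (((integrable_abs_pow_of_le (k := q) (by omega) hν).div_const _).const_mul _)
      (Filter.Eventually.of_forall fun x => ?_)
    have h := abs_sub_taylor_le (m := q) (G := fun k => G (k + 1))
      (fun k hk => hG (k + 1) (by omega)) (hm (q + 1) le_rfl) (c * x)
    have h2 : ∑ k ∈ Finset.range q, G (k + 1) 0 * c ^ k / (k.factorial : ℝ) * x ^ k
        = ∑ k ∈ Finset.range q, G (k + 1) 0 * (c * x) ^ k / (k.factorial : ℝ) := by
      refine Finset.sum_congr rfl fun k _ => ?_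
      ring
    rw [Real.norm_eq_abs, h2]
    refine h.trans (le_of_eq ?_)
    rw [abs_mul, abs_of_nonneg hc]
    ring
  have hM : |c * (∑ k ∈ Finset.range (q + 1),
          G k 0 * c ^ k / (k.factorial : ℝ) * ∫ x, x ^ (k + 1) ∂ν)
        - c ^ 2 * ∑ k ∈ Finset.range q, G (k + 1) 0 * c ^ k / (k.factorial : ℝ) * ∫ x, x ^ k ∂ν|
      ≤ c * |momentMismatch ν id 1| * m 0
        + ∑ k ∈ Finset.range q, c ^ (k + 2) / ((k + 1).factorial : ℝ) * m (k + 1)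
            * |((k : ℝ) + 1) * momentMismatch ν id k - momentMismatch ν id (k + 2)| := by
    -- The k = 0 term stands alone and is a mismatch because E Z = 0. The others pair index k + 1 of
    -- the first sum with index k of the second.
    have h1 : c * (∑ k ∈ Finset.range (q + 1),
          G k 0 * c ^ k / (k.factorial : ℝ) * ∫ x, x ^ (k + 1) ∂ν)
        - c ^ 2 * ∑ k ∈ Finset.range q, G (k + 1) 0 * c ^ k / (k.factorial : ℝ) * ∫ x, x ^ k ∂ν
        = c * momentMismatch ν id 1 * G 0 0
          + ∑ k ∈ Finset.range q, -(c ^ (k + 2) / ((k + 1).factorial : ℝ) * G (k + 1) 0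
            * (((k : ℝ) + 1) * momentMismatch ν id k - momentMismatch ν id (k + 2))) := by
      rw [Finset.sum_range_succ', mul_add, add_sub_right_comm, Finset.mul_sum, Finset.mul_sum,
        ← Finset.sum_sub_distrib, add_comm]
      congr 1
      · simp [momentMismatch, integral_id_gaussianReal]
        ring
      · refine Finset.sum_congr rfl fun k _ => ?_
        simp only [momentMismatch, id_eq, integral_pow_add_two_gaussianReal, Nat.factorial_succ]
        push_cast
        field_simp
        ring
    rw [h1]
    refine (abs_add_le _ _).trans (add_le_add ?_ ((Finset.abs_sum_le_sum_abs _ _).trans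
      (Finset.sum_le_sum fun k hk => ?_)))
    · rw [abs_mul, abs_mul, abs_of_nonneg hc]
      gcongr
      exact hm 0 (by omega) 0
    · rw [abs_neg, abs_mul, abs_mul, abs_of_nonneg (by positivity : 0 ≤ c ^ (k + 2) / _)]
      gcongr
      exact hm (k + 1) (by simp at hk; omega) 0
  set A := ∫ x, x * G 0 (c * x) ∂ν
  set B := ∫ x, G 1 (c * x) ∂ν
  set S := ∑ k ∈ Finset.range (q + 1), G k 0 * c ^ k / (k.factorial : ℝ) * ∫ x, x ^ (k + 1) ∂ν
  set T := ∑ k ∈ Finset.range q, G (k + 1) 0 * c ^ k / (k.factorial : ℝ) * ∫ x, x ^ k ∂ν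
  have h1 : c * A - c ^ 2 * B = (c * S - c ^ 2 * T) + c * (A - S) - c ^ 2 * (B - T) := by ring
  rw [h1]
  refine (abs_sub _ _).trans ((add_le_add_left (abs_add_le _ _) _).trans ?_)
  rw [abs_mul c, abs_mul (c ^ 2), abs_of_nonneg hc, abs_of_nonneg (sq_nonneg c)]
  have h2 := mul_le_mul_of_nonneg_left hR0 hc
  have h3 := mul_le_mul_of_nonneg_left hR1 (sq_nonneg c)
  refine (add_le_add (add_le_add hM h2) h3).trans (le_of_eq ?_)
  ring

/-! ### Resampling a coordinate of a product measure -/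

section Pi

variable {ι : Type*} [Fintype ι] [DecidableEq ι] {μ : ι → Measure ℝ}
  [∀ i, IsProbabilityMeasure (μ i)]

/-- Resampling one coordinate preserves a product of probability measures. -/
lemma measurePreserving_update (a : ι) :
    MeasurePreserving (fun z : (ι → ℝ) × ℝ => Function.update z.1 a z.2)
      ((Measure.pi μ).prod (μ a)) (Measure.pi μ) := by
  have hmeas : Measurable (fun z : (ι → ℝ) × ℝ => Function.update z.1 a z.2) := by
    refine measurable_pi_lambda _ fun i => ?_
    by_cases hi : i = a
    · subst hi; simpa using measurable_snd
    · simp only [Function.update_of_ne hi]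
      fun_prop
  refine ⟨hmeas, (Measure.pi_eq fun s hs => ?_).symm⟩
  rw [Measure.map_apply hmeas (MeasurableSet.univ_pi hs)]
  -- The old value of coordinate `a` is overwritten, hence unconstrained.
  have hpre : (fun z : (ι → ℝ) × ℝ => Function.update z.1 a z.2) ⁻¹' (Set.univ.pi s)
      = (Set.univ.pi (Function.update s a Set.univ)) ×ˢ (s a) := by
    ext ⟨x, t⟩
    simp only [Set.mem_preimage, Set.mem_univ_pi, Set.mem_prod]
    constructor
    · intro h
      refine ⟨fun i => ?_, by simpa using h a⟩
      by_cases hi : i = a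
      · subst hi; simp
      · simpa [hi] using h i
    · rintro ⟨h, ha⟩ i
      by_cases hi : i = a
      · subst hi; simpa using ha
      · simpa [hi] using h i
  rw [hpre, Measure.prod_prod, Measure.pi_pi, ← Finset.prod_erase_mul _ _ (Finset.mem_univ a),
    ← Finset.prod_erase_mul _ (fun i => μ i (s i)) (Finset.mem_univ a)]
  simp only [Function.update_self, measure_univ, mul_one]
  congr 1
  refine Finset.prod_congr rfl fun i hi => ?_
  rw [Function.update_of_ne (Finset.ne_of_mem_erase hi)]

lemma integrable_pi_update {F : (ι → ℝ) → ℝ} (hF : Integrable F (Measure.pi μ)) (a : ι) :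
    Integrable (fun z : (ι → ℝ) × ℝ => F (Function.update z.1 a z.2))
      ((Measure.pi μ).prod (μ a)) :=
  (measurePreserving_update a).integrable_comp_of_integrable hF

lemma integral_pi_eq_prod {F : (ι → ℝ) → ℝ} (hF : Integrable F (Measure.pi μ)) (a : ι) :
    ∫ x, F x ∂(Measure.pi μ)
      = ∫ z, F (Function.update z.1 a z.2) ∂((Measure.pi μ).prod (μ a)) := by
  have h := measurePreserving_update (μ := μ) a
  conv_lhs => rw [← h.map_eq]
  exact integral_map h.measurable.aemeasurable (by rw [h.map_eq]; exact hF.aestronglyMeasurable)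

lemma integral_pi_update {F : (ι → ℝ) → ℝ} (hF : Integrable F (Measure.pi μ)) (a : ι) :
    ∫ x, F x ∂(Measure.pi μ) = ∫ x, ∫ t, F (Function.update x a t) ∂(μ a) ∂(Measure.pi μ) := by
  rw [integral_pi_eq_prod hF a, integral_prod _ (integrable_pi_update hF a)]

lemma integral_pi_update_symm {F : (ι → ℝ) → ℝ} (hF : Integrable F (Measure.pi μ)) (a : ι) :
    ∫ x, F x ∂(Measure.pi μ) = ∫ t, ∫ x, F (Function.update x a t) ∂(Measure.pi μ) ∂(μ a) := by
  rw [integral_pi_eq_prod hF a, integral_prod_symm _ (integrable_pi_update hF a)]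

end Pi

/-! ### Directional derivatives and linear combinations of independent coordinates -/

section Linear

lemma integrable_comp_of_abs_le {E Ω : Type*} [MeasurableSpace E] [MeasurableSpace Ω] {P : Measure Ω}
    [IsFiniteMeasure P] {D : E → ℝ} (hD : Measurable D) {C : ℝ} (hC : ∀ w, |D w| ≤ C) {Y : Ω → E}
    (hY : Measurable Y) :
    Integrable (fun ω => D (Y ω)) P :=
  Integrable.of_bound (hD.comp hY).aestronglyMeasurable C
    (Filter.Eventually.of_forall fun _ => hC _)

/-- Zeroing the direction `v a`, rather than removing the index, keeps the remaining sum on the same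
product space and independent of `x a`. -/
lemma sum_update_smul {ι E : Type*} [Fintype ι] [DecidableEq ι] [AddCommGroup E] [Module ℝ E]
    (v : ι → E) (a : ι) (x : ι → ℝ) (t : ℝ) :
    ∑ i, Function.update x a t i • v i = ∑ i, x i • Function.update v a 0 i + t • v a := by
  rw [← Finset.sum_erase_add _ _ (Finset.mem_univ a),
    ← Finset.sum_erase_add Finset.univ (fun i => x i • Function.update v a 0 i) (Finset.mem_univ a)]
  simp only [Function.update_self, smul_zero, add_zero]
  congr 1
  refine Finset.sum_congr rfl fun i hi => ?_
  rw [Function.update_of_ne (Finset.ne_of_mem_erase hi),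
    Function.update_of_ne (Finset.ne_of_mem_erase hi)]

lemma integrable_eval_mul {ι E : Type*} [Fintype ι] [MeasurableSpace E] {μ : ι → Measure ℝ}
    [∀ i, IsProbabilityMeasure (μ i)] (a : ι) (ha : Integrable (fun t => t) (μ a))
    {D : E → ℝ} (hD : Measurable D) {C : ℝ} (hC : ∀ w, |D w| ≤ C) {Y : (ι → ℝ) → E}
    (hY : Measurable Y) :
    Integrable (fun x => x a * D (Y x)) (Measure.pi μ) :=
  (integrable_comp_eval (μ := μ) (i := a) (f := fun t : ℝ => t) ha).mul_bdd (c := C)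
    (hD.comp hY).aestronglyMeasurable (Filter.Eventually.of_forall fun _ => hC _)

variable {E : Type*} [NormedAddCommGroup E] [NormedSpace ℝ E] [MeasurableSpace E]

/-- `D` and `D'` are bounded and measurable, and `D'` is the derivative of `D` along `e`. -/
structure BoundedDirDeriv (e : E) (D D' : E → ℝ) (C C' : ℝ) : Prop where
  measurable : Measurable D
  measurable' : Measurable D'
  bound : ∀ w, |D w| ≤ C
  bound' : ∀ w, |D' w| ≤ C'
  hasDerivAt : ∀ w t, HasDerivAt (fun t : ℝ => D (w + t • e)) (D' (w + t • e)) t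

variable {e : E} {D D' : E → ℝ} {C C' : ℝ}

lemma BoundedDirDeriv.hasDerivAt_mul (h : BoundedDirDeriv e D D' C C') (b : ℝ) (w : E) (t : ℝ) :
    HasDerivAt (fun t : ℝ => D (w + (t * b) • e)) (b * D' (w + (t * b) • e)) t := by
  have := (h.hasDerivAt w (t * b)).comp t ((hasDerivAt_id t).mul_const b)
  refine this.congr_deriv ?_
  ring

variable [BorelSpace E]

lemma BoundedDirDeriv.hasDerivAt_integral {Ω : Type*} [MeasurableSpace Ω] {P : Measure Ω}
    [IsProbabilityMeasure P] (h : BoundedDirDeriv e D D' C C') (b : ℝ) {Y : Ω → E}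
    (hY : Measurable Y) (t : ℝ) :
    HasDerivAt (fun t : ℝ => ∫ ω, D (Y ω + (t * b) • e) ∂P)
      (b * ∫ ω, D' (Y ω + (t * b) • e) ∂P) t := by
  have hY' : ∀ s : ℝ, Measurable (fun ω => Y ω + (s * b) • e) := fun s => by fun_prop
  rw [← integral_const_mul]
  refine (hasDerivAt_integral_of_dominated_loc_of_deriv_le (bound := fun _ => |b| * C')
    (F := fun s ω => D (Y ω + (s * b) • e)) (F' := fun s ω => b * D' (Y ω + (s * b) • e))
    (s := Set.univ) Filter.univ_mem
    (Filter.Eventually.of_forall fun s => (h.measurable.comp (hY' s)).aestronglyMeasurable)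
    (integrable_comp_of_abs_le h.measurable h.bound (hY' t))
    ((h.measurable'.comp (hY' t)).const_mul b).aestronglyMeasurable
    (Filter.Eventually.of_forall fun ω s _ => ?_) (integrable_const _)
    (Filter.Eventually.of_forall fun ω s _ => h.hasDerivAt_mul b _ s)).2
  rw [Real.norm_eq_abs, abs_mul]
  exact mul_le_mul_of_nonneg_left (h.bound' _) (abs_nonneg _)

variable {ι : Type*} [Fintype ι] [DecidableEq ι] {μ : ι → Measure ℝ}
  [∀ i, IsProbabilityMeasure (μ i)]
  [SecondCountableTopology E]

/-- Gaussian integration by parts in one coordinate of a product measure. -/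
lemma BoundedDirDeriv.integral_eval_mul (h : BoundedDirDeriv e D D' C C') {a : ι}
    (ha : μ a = gaussianReal 0 1) {v : ι → E} {b : ℝ} (hv : v a = b • e) (w : E) :
    ∫ x, x a * D (w + ∑ i, x i • v i) ∂(Measure.pi μ)
      = b * ∫ x, D' (w + ∑ i, x i • v i) ∂(Measure.pi μ) := by
  have hY : Measurable (fun x : ι → ℝ => w + ∑ i, x i • v i) := by fun_prop
  have hid : Integrable (fun t : ℝ => t) (gaussianReal 0 1) := by
    simpa using integrable_pow_gaussianReal 1
  rw [integral_pi_update (integrable_eval_mul a (by rw [ha]; exact hid) h.measurable h.bound hY) a,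
    integral_pi_update (integrable_comp_of_abs_le h.measurable' h.bound' hY) a,
    ← integral_const_mul]
  congr 1 with x
  simp only [sum_update_smul, hv, Function.update_self, ha, smul_smul, ← add_assoc]
  set y := w + ∑ i, x i • Function.update v a 0 i
  have hY' : Measurable (fun t : ℝ => y + (t * b) • e) := by fun_prop
  rw [← integral_const_mul]
  exact integral_mul_gaussianReal (fun t => h.hasDerivAt_mul b y t)
    (integrable_comp_of_abs_le h.measurable h.bound hY')
    ((integrable_comp_of_abs_le h.measurable' h.bound' hY').const_mul b)
    (hid.mul_bdd (c := C) (h.measurable.comp hY').aestronglyMeasurable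
      (Filter.Eventually.of_forall fun x => h.bound _))

/-- Integration by parts trades the derivative `D'` for the factor `x a`, whose absolute mean is
√(2/π); only a bound on `D` then enters. -/
lemma BoundedDirDeriv.abs_mul_integral_le (h : BoundedDirDeriv e D D' C C') {a : ι}
    (ha : μ a = gaussianReal 0 1) {v : ι → E} {b : ℝ} (hv : v a = b • e) (w : E) :
    |b * ∫ x, D' (w + ∑ i, x i • v i) ∂(Measure.pi μ)| ≤ √(2 / Real.pi) * C := by
  have hid : Integrable (fun t : ℝ => |t|) (gaussianReal 0 1) := by
    simpa using (integrable_pow_gaussianReal 1).abs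
  have habs : ∫ x, |x a| ∂(Measure.pi μ) = √(2 / Real.pi) := by
    rw [← integral_abs_gaussianReal, ← ha]
    exact integral_comp_eval (μ := μ) (i := a) (f := fun t : ℝ => |t|) (by fun_prop)
  rw [← h.integral_eval_mul ha hv w, ← habs, ← integral_mul_const, ← Real.norm_eq_abs]
  refine norm_integral_le_of_norm_le
    ((integrable_comp_eval (μ := μ) (i := a) (f := fun t : ℝ => |t|)
      (by rw [ha]; exact hid)).mul_const C)
    (Filter.Eventually.of_forall fun x => ?_)
  rw [Real.norm_eq_abs, abs_mul]
  exact mul_le_mul_of_nonneg_left (h.bound _) (abs_nonneg _)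

end Linear

/-! ### Iterated partial derivatives of functions in C_b -/

section Cb

variable {d m : ℕ} {h : EuclideanSpace ℝ (Fin d) → ℝ}

lemma iterPartialDeriv_succ (j : Fin d) (k : ℕ) (g : EuclideanSpace ℝ (Fin d) → ℝ) :
    iterPartialDeriv j (k + 1) g = partialDeriv j (iterPartialDeriv j k g) :=
  Function.iterate_succ_apply' _ _ _

lemma IsCb.differentiable_apply (hh : IsCb m h) {k : ℕ} (hk : k < m)
    (v : Fin k → EuclideanSpace ℝ (Fin d)) :
    Differentiable ℝ (fun w => iteratedFDeriv ℝ k h w v) := fun w =>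
  ((hh.differentiable k hk w).hasFDerivAt.continuousMultilinear_apply_const v).differentiableAt

lemma IsCb.fderiv_apply (hh : IsCb m h) {k : ℕ} (hk : k < m) (e w : EuclideanSpace ℝ (Fin d)) :
    fderiv ℝ (fun w => iteratedFDeriv ℝ k h w (fun _ => e)) w e
      = iteratedFDeriv ℝ (k + 1) h w (fun _ => e) := by
  rw [((hh.differentiable k hk w).hasFDerivAt.continuousMultilinear_apply_const _).fderiv,
    iteratedFDeriv_succ_apply_left]
  rfl

lemma IsCb.iterPartialDeriv_eq (hh : IsCb m h) (j : Fin d) {k : ℕ} (hk : k ≤ m) :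
    iterPartialDeriv j k h
      = fun w => iteratedFDeriv ℝ k h w (fun _ => EuclideanSpace.single j (1 : ℝ)) := by
  induction k with
  | zero => ext w; simp [iterPartialDeriv]
  | succ k ih =>
    ext w
    rw [iterPartialDeriv_succ, ih (by omega), partialDeriv,
      (hh.differentiable_apply (by omega) _ w).lineDeriv_eq_fderiv, hh.fderiv_apply (by omega)]

lemma IsCb.abs_iterPartialDeriv_le (hh : IsCb m h) (j : Fin d) {k : ℕ} (hk : k ≤ m)
    (w : EuclideanSpace ℝ (Fin d)) :
    |iterPartialDeriv j k h w| ≤ supNorm (iterPartialDeriv j k h) := by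
  obtain ⟨C, hC⟩ := hh.bounded k hk
  refine le_ciSup (f := fun w => |iterPartialDeriv j k h w|) ⟨C, ?_⟩ w
  rintro _ ⟨w, rfl⟩
  simp only [hh.iterPartialDeriv_eq j hk]
  refine ((iteratedFDeriv ℝ k h w).le_opNorm _).trans ?_
  simpa using hC w

lemma IsCb.continuous_iterPartialDeriv (hh : IsCb m h) (j : Fin d) {k : ℕ} (hk : k < m) :
    Continuous (iterPartialDeriv j k h) := by
  rw [hh.iterPartialDeriv_eq j hk.le]
  exact (hh.differentiable_apply hk _).continuous

/-- The top derivative need not be continuous, but it is a line derivative of a continuous function.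
-/
lemma IsCb.measurable_iterPartialDeriv (hh : IsCb m h) (j : Fin d) {k : ℕ} (hk : k < m) :
    Measurable (iterPartialDeriv j (k + 1) h) := by
  rw [iterPartialDeriv_succ]
  exact measurable_lineDeriv (hh.continuous_iterPartialDeriv j hk)

lemma IsCb.boundedDirDeriv (hh : IsCb m h) (j : Fin d) {k : ℕ} (hk : k < m) :
    BoundedDirDeriv (EuclideanSpace.single j (1 : ℝ)) (iterPartialDeriv j k h)
      (iterPartialDeriv j (k + 1) h) (supNorm (iterPartialDeriv j k h))
      (supNorm (iterPartialDeriv j (k + 1) h)) where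
  measurable := (hh.continuous_iterPartialDeriv j hk).measurable
  measurable' := hh.measurable_iterPartialDeriv j hk
  bound := hh.abs_iterPartialDeriv_le j hk.le
  bound' := hh.abs_iterPartialDeriv_le j hk
  hasDerivAt w t := by
    rw [hh.iterPartialDeriv_eq j hk.le, hh.iterPartialDeriv_eq j hk]
    have h1 : HasDerivAt (fun t : ℝ => w + t • EuclideanSpace.single j (1 : ℝ))
        (EuclideanSpace.single j (1 : ℝ)) t := by
      simpa using ((hasDerivAt_id t).smul_const (EuclideanSpace.single j (1 : ℝ))).const_add w
    have h2 := (hh.differentiable_apply hk (fun _ => EuclideanSpace.single j (1 : ℝ))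
      (w + t • EuclideanSpace.single j (1 : ℝ))).hasFDerivAt.comp_hasDerivAt t h1
    exact h2.congr_deriv (hh.fderiv_apply hk _ _)

lemma IsCb.differentiable_self (hh : IsCb m h) (hm : 0 < m) : Differentiable ℝ h := by
  have := hh.differentiable_apply hm (fun _ => 0)
  simpa using this

lemma IsCb.partialDeriv_eq_fderiv (hh : IsCb m h) (hm : 0 < m) (j : Fin d)
    (w : EuclideanSpace ℝ (Fin d)) :
    iterPartialDeriv j 1 h w = fderiv ℝ h w (EuclideanSpace.single j (1 : ℝ)) :=
  (hh.differentiable_self hm w).lineDeriv_eq_fderiv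

end Cb

/-! ### Contribution of one coordinate, and differentiation along the path -/

section Step

variable {E : Type*} [NormedAddCommGroup E] [NormedSpace ℝ E] [MeasurableSpace E] [BorelSpace E]
  [SecondCountableTopology E] {ι : Type*} [Fintype ι] {μ : ι → Measure ℝ}
  [∀ i, IsProbabilityMeasure (μ i)]

/-- The contribution of one coordinate `a` to the derivative of the interpolation, at a point
where a Gaussian coordinate `g` in the same direction carries the weight `b`. -/
lemma abs_stein_coordinate_le {q : ℕ} {e : E} {D : ℕ → E → ℝ} {N : ℕ → ℝ}
    (hD : ∀ k ≤ q, BoundedDirDeriv e (D (k + 1)) (D (k + 2)) (N (k + 1)) (N (k + 2)))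
    [DecidableEq ι] {a g : ι} (hga : g ≠ a) (hg : μ g = gaussianReal 0 1)
    (ha : Integrable (fun x => |x| ^ (q + 2)) (μ a)) {v : ι → E} {b c s : ℝ} (hb : 0 < b)
    (hc : 0 ≤ c) (hs : 0 ≤ s) (hva : v a = (c * s) • e) (hvg : v g = b • e) :
    b * |c * (∫ x, x a * D 1 (∑ i, x i • v i) ∂(Measure.pi μ))
        - c ^ 2 * (s * ∫ x, D 2 (∑ i, x i • v i) ∂(Measure.pi μ))|
      ≤ b * (c * |momentMismatch (μ a) id 1| * N 1)
        + (∑ k ∈ Finset.range q, c ^ (k + 2) / ((k + 1).factorial : ℝ)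
            * min (√(2 / Real.pi) * s ^ (k + 1) * N (k + 1)) (b * s ^ (k + 1) * N (k + 2))
            * |((k : ℝ) + 1) * momentMismatch (μ a) id k - momentMismatch (μ a) id (k + 2)|)
        + c ^ (q + 2) * min (√(2 / Real.pi) * s ^ (q + 1) * N (q + 1)) (b * s ^ (q + 1) * N (q + 2))
          * ((∫ x, |x| ^ q ∂(μ a)) / (q.factorial : ℝ)
            + (∫ x, |x| ^ (q + 2) ∂(μ a)) / ((q + 1).factorial : ℝ)) := by
  set v' := Function.update v a 0
  set Y : (ι → ℝ) → E := fun x => ∑ i, x i • v' i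
  have hY : Measurable Y := by fun_prop
  have hYv : Measurable (fun x : ι → ℝ => ∑ i, x i • v i) := by fun_prop
  -- `G 0` averages `D 1` over everything except coordinate `a`, whose scaled value is the variable
  -- t; `G k` is its k-th derivative.
  set G : ℕ → ℝ → ℝ := fun k t => s ^ k * ∫ x, D (k + 1) (Y x + (t * s) • e) ∂(Measure.pi μ)
  set β : ℕ → ℝ := fun k => min (√(2 / Real.pi) * s ^ k * N k) (b * s ^ k * N (k + 1))
  -- Dividing by `b` anticipates the prefactor `b` of the conclusion. At k = 0 the plain bound `N 1`
  -- is kept, as the statement involves no `N 0`.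
  set m : ℕ → ℝ := fun k => if k = 0 then N 1 else β k / b
  have hint : Integrable (fun t : ℝ => t) (μ a) := by
    simpa using integrable_pow_of_le (k := 1) (by omega) ha
  have hN : ∀ k ≤ q + 1, ∀ w, |D (k + 1) w| ≤ N (k + 1) := by
    intro k hk w
    rcases Nat.lt_or_ge k (q + 1) with h | h
    · exact (hD k (by omega)).bound w
    · obtain rfl : k = q + 1 := by omega
      exact (hD q le_rfl).bound' w
  have hG : ∀ k < q + 1, ∀ t, HasDerivAt (G k) (G (k + 1) t) t := by
    intro k hk t
    refine (((hD k (by omega)).hasDerivAt_integral s hY t).const_mul (s ^ k)).congr_deriv ?_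
    simp only [G]
    ring
  have hbound : ∀ k ≤ q + 1, ∀ t,
      |∫ x, D (k + 1) (Y x + (t * s) • e) ∂(Measure.pi μ)| ≤ N (k + 1) := by
    intro k hk t
    have := norm_integral_le_of_norm_le_const (μ := Measure.pi μ)
      (f := fun x => D (k + 1) (Y x + (t * s) • e))
      (Filter.Eventually.of_forall fun x => hN k hk (Y x + (t * s) • e))
    simpa using this
  have hm : ∀ k ≤ q + 1, ∀ t, |G k t| ≤ m k := by
    intro k hk t
    rcases k with _ | k
    · simpa [G, m] using hbound 0 (by omega) t
    · simp only [m, Nat.succ_ne_zero, if_false, G]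
      rw [le_div_iff₀ hb, abs_mul, abs_of_nonneg (pow_nonneg hs _)]
      refine le_min ?_ ?_
      -- Since `g ≠ a`, the Gaussian coordinate keeps its weight `b` in `v'` and can be integrated
      -- by parts.
      · have h := (hD k (by omega)).abs_mul_integral_le (μ := μ) hg (v := v') (b := b)
          (by simp only [v', Function.update_of_ne hga, hvg]) ((t * s) • e)
        rw [abs_mul, abs_of_pos hb] at h
        simp_rw [add_comm ((t * s) • e)] at h
        have := mul_le_mul_of_nonneg_left h (pow_nonneg hs (k + 1))
        calc _ = s ^ (k + 1) * (b * |∫ x, D (k + 2) (Y x + (t * s) • e) ∂(Measure.pi μ)|) := by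
              ring
          _ ≤ _ := this
          _ = _ := by ring
      · have h := hbound (k + 1) hk t
        have := mul_le_mul_of_nonneg_left h (mul_nonneg hb.le (pow_nonneg hs (k + 1)))
        calc _ = b * s ^ (k + 1)
                * |∫ x, D (k + 2) (Y x + (t * s) • e) ∂(Measure.pi μ)| := by ring
          _ ≤ _ := this
  have hupd : ∀ (x : ι → ℝ) (t : ℝ),
      ∑ i, Function.update x a t i • v i = Y x + (c * t * s) • e := by
    intro x t
    rw [sum_update_smul, hva, smul_smul]
    congr 2
    ring
  have h1 : ∫ x, x a * D 1 (∑ i, x i • v i) ∂(Measure.pi μ) = ∫ t, t * G 0 (c * t) ∂(μ a) := by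
    rw [integral_pi_update_symm
      (integrable_eval_mul a hint (hD 0 (by omega)).measurable (hN 0 (by omega)) hYv) a]
    congr 1 with t
    simp only [Function.update_self, hupd, G, pow_zero, one_mul, zero_add]
    rw [integral_const_mul]
  have h2 : s * ∫ x, D 2 (∑ i, x i • v i) ∂(Measure.pi μ) = ∫ t, G 1 (c * t) ∂(μ a) := by
    rw [integral_pi_update_symm
      (integrable_comp_of_abs_le (hD 0 (by omega)).measurable' (hN 1 (by omega)) hYv) a,
      ← integral_const_mul]
    congr 1 with t
    simp only [hupd, G, pow_one]
  rw [h1, h2]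
  have key := mul_le_mul_of_nonneg_left (abs_integral_sub_le ha hc hG hm) hb.le
  refine key.trans (le_of_eq ?_)
  have hβ : ∀ k, b * m (k + 1) = β (k + 1) := fun k => by
    simp only [m, Nat.succ_ne_zero, if_false]
    field_simp
  rw [mul_add, mul_add, Finset.mul_sum]
  congr 1
  · congr 1
    refine Finset.sum_congr rfl fun k _ => ?_
    change _ = _ * β (k + 1) * _
    rw [← hβ k]
    ring
  · change _ = _ * β (q + 1) * _
    rw [← hβ q]
    ring

/-- Differentiation of the expectation along a path of linear combinations of independent
coordinates. -/
lemma hasDerivAt_integral_linear_path {h : E → ℝ} {C : ℝ} (hh : Differentiable ℝ h)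
    (hC : ∀ w, |h w| ≤ C) {e : ι → E} {N : ι → ℝ} (hN : ∀ i w, |fderiv ℝ h w (e i)| ≤ N i)
    (hμ : ∀ i, Integrable (fun t : ℝ => t) (μ i)) {f f' : ι → ℝ → ℝ} {K : ℝ}
    (hf : ∀ i θ, HasDerivAt (f i) (f' i θ) θ) (hK : ∀ i θ, |f' i θ| ≤ K) (θ : ℝ) :
    HasDerivAt (fun θ => ∫ x, h (∑ i, x i • f i θ • e i) ∂(Measure.pi μ))
      (∑ i, f' i θ * ∫ x, x i * fderiv ℝ h (∑ l, x l • f l θ • e l) (e i) ∂(Measure.pi μ)) θ := by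
  have hV : ∀ θ, Measurable (fun x : ι → ℝ => ∑ i, x i • f i θ • e i) := fun θ => by fun_prop
  have hD : ∀ i, Measurable (fun w => fderiv ℝ h w (e i)) := fun i =>
    measurable_fderiv_apply_const ℝ h (e i)
  have hint : ∀ i θ, Integrable
      (fun x => f' i θ * (x i * fderiv ℝ h (∑ l, x l • f l θ • e l) (e i))) (Measure.pi μ) :=
    fun i θ => (integrable_eval_mul i (hμ i) (hD i) (hN i) (hV θ)).const_mul _
  simp_rw [← integral_const_mul]
  rw [← integral_finsetSum _ fun i _ => hint i θ]
  have hderiv : ∀ (x : ι → ℝ) θ, HasDerivAt (fun θ => h (∑ i, x i • f i θ • e i))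
      (∑ i, f' i θ * (x i * fderiv ℝ h (∑ l, x l • f l θ • e l) (e i))) θ := by
    intro x θ
    have h1 : HasDerivAt (fun θ => ∑ i, x i • f i θ • e i) (∑ i, x i • f' i θ • e i) θ :=
      HasDerivAt.fun_sum fun i _ => ((hf i θ).smul_const (e i)).const_smul (x i)
    refine ((hh _).hasFDerivAt.comp_hasDerivAt θ h1).congr_deriv ?_
    simp only [map_sum, map_smul, smul_eq_mul]
    exact Finset.sum_congr rfl fun i _ => by ring
  -- Dominating function, uniform in θ; it needs only first absolute moments.
  have hbd : Integrable (fun x : ι → ℝ => ∑ i, K * (|x i| * N i)) (Measure.pi μ) :=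
    integrable_finsetSum _ fun i _ => ((integrable_comp_eval (μ := μ) (i := i)
      (f := fun t : ℝ => |t|) (hμ i).abs).mul_const _).const_mul _
  have hle : ∀ (x : ι → ℝ) θ,
      ‖∑ i, f' i θ * (x i * fderiv ℝ h (∑ l, x l • f l θ • e l) (e i))‖
        ≤ ∑ i, K * (|x i| * N i) := by
    intro x θ
    refine (Finset.abs_sum_le_sum_abs _ _).trans (Finset.sum_le_sum fun i _ => ?_)
    rw [abs_mul, abs_mul]
    exact mul_le_mul (hK i θ) (mul_le_mul_of_nonneg_left (hN i _) (abs_nonneg _))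
      (by positivity) ((abs_nonneg _).trans (hK i θ))
  have h0 := integrable_comp_of_abs_le (P := Measure.pi μ) hh.continuous.measurable hC (hV θ)
  have h1 : ∀ᶠ η in nhds θ,
      AEStronglyMeasurable (fun x => h (∑ i, x i • f i η • e i)) (Measure.pi μ) :=
    Filter.Eventually.of_forall fun η =>
      (hh.continuous.measurable.comp (hV η)).aestronglyMeasurable
  have h2 := (integrable_finsetSum Finset.univ fun i _ => hint i θ).aestronglyMeasurable
  exact (hasDerivAt_integral_of_dominated_loc_of_deriv_le (s := Set.univ)
    (F := fun θ (x : ι → ℝ) => h (∑ i, x i • f i θ • e i))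
    (F' := fun θ (x : ι → ℝ) =>
      ∑ i, f' i θ * (x i * fderiv ℝ h (∑ l, x l • f l θ • e l) (e i)))
    Filter.univ_mem h1 h0 h2
    (Filter.Eventually.of_forall fun x θ _ => hle x θ) hbd
    (Filter.Eventually.of_forall fun x θ _ => hderiv x θ)).2

end Step

/-! ### The trigonometric interpolation between W and Z -/

section Interpolation

variable {n d q : ℕ} {h : EuclideanSpace ℝ (Fin d) → ℝ}

/-- The factor multiplying the moment mismatches along the interpolation; it integrates to at most
`M h j k`. -/
noncomputable def interpolationFactor (h : EuclideanSpace ℝ (Fin d) → ℝ) (j : Fin d) (k : ℕ)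
    (θ : ℝ) : ℝ :=
  min (√(2 / Real.pi) * Real.sin θ ^ k * supNorm (iterPartialDeriv j k h))
    (Real.cos θ * Real.sin θ ^ k * supNorm (iterPartialDeriv j (k + 1) h))

lemma continuous_interpolationFactor (j : Fin d) (k : ℕ) :
    Continuous (interpolationFactor h j k) := by
  unfold interpolationFactor
  fun_prop

/-- The integral of a minimum is at most each of the two integrals, and these are the two terms of
`M`. -/
lemma integral_interpolationFactor_le (j : Fin d) (k : ℕ) :
    ∫ θ in (0 : ℝ)..(Real.pi / 2), interpolationFactor h j k θ ≤ M h j k := by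
  have hpi : (0 : ℝ) ≤ Real.pi / 2 := by positivity
  have hc := (continuous_interpolationFactor (h := h) j k).intervalIntegrable (μ := volume) 0
    (Real.pi / 2)
  refine le_min ?_ ?_
  · refine (intervalIntegral.integral_mono_on (g := fun θ =>
      √(2 / Real.pi) * Real.sin θ ^ k * supNorm (iterPartialDeriv j k h)) hpi hc
      (Continuous.intervalIntegrable (by fun_prop) _ _) fun θ _ => min_le_left _ _).trans
      (le_of_eq ?_)
    rw [intervalIntegral.integral_mul_const, intervalIntegral.integral_const_mul,
      sqrt_two_div_pi_mul_integral_sin_pow]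
  · refine (intervalIntegral.integral_mono_on (g := fun θ =>
      Real.cos θ * Real.sin θ ^ k * supNorm (iterPartialDeriv j (k + 1) h)) hpi hc
      (Continuous.intervalIntegrable (by fun_prop) _ _) fun θ _ => min_le_right _ _).trans
      (le_of_eq ?_)
    rw [intervalIntegral.integral_mul_const, integral_cos_mul_sin_pow]

/-- The laws of the summands together with those of the coordinates of a standard normal vector. -/
noncomputable def jointLaw (ν : Fin n × Fin d → Measure ℝ) : (Fin n × Fin d) ⊕ Fin d → Measure ℝ :=
  Sum.elim ν fun _ => gaussianReal 0 1

instance (ν : Fin n × Fin d → Measure ℝ) [∀ i, IsProbabilityMeasure (ν i)] :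
    ∀ i, IsProbabilityMeasure (jointLaw ν i) := by
  rintro (i | j)
  · exact inferInstanceAs (IsProbabilityMeasure (ν i))
  · exact inferInstanceAs (IsProbabilityMeasure (gaussianReal 0 1))

/-- The direction in which each coordinate enters the interpolation. -/
noncomputable def direction : (Fin n × Fin d) ⊕ Fin d → EuclideanSpace ℝ (Fin d) :=
  Sum.elim (fun i => EuclideanSpace.single i.2 1) fun j => EuclideanSpace.single j 1

/-- The weights of the coordinates in `sin θ • W + cos θ • Z`. -/
noncomputable def weight (c : ℝ) : (Fin n × Fin d) ⊕ Fin d → ℝ → ℝ :=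
  Sum.elim (fun _ θ => c * Real.sin θ) fun _ θ => Real.cos θ

/-- The derivatives of the weights of the coordinates in `sin θ • W + cos θ • Z`. -/
noncomputable def weightDeriv (c : ℝ) : (Fin n × Fin d) ⊕ Fin d → ℝ → ℝ :=
  Sum.elim (fun _ θ => c * Real.cos θ) fun _ θ => -Real.sin θ

/-- The point `sin θ • W + cos θ • Z`. -/
noncomputable def interpolant (c θ : ℝ) (x : (Fin n × Fin d) ⊕ Fin d → ℝ) :
    EuclideanSpace ℝ (Fin d) :=
  ∑ i, x i • weight c i θ • direction i

variable {ν : Fin n × Fin d → Measure ℝ} [∀ i, IsProbabilityMeasure (ν i)]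

lemma hasDerivAt_integral_interpolant (hh : IsCb (q + 2) h)
    (hν : ∀ i, Integrable (fun t : ℝ => t) (ν i)) {c : ℝ} (hc : n * c ^ 2 = 1) (θ : ℝ) :
    HasDerivAt (fun θ => ∫ x, h (interpolant c θ x) ∂(Measure.pi (jointLaw ν)))
      (∑ i : Fin n × Fin d, Real.cos θ *
        (c * (∫ x, x (Sum.inl i) * iterPartialDeriv i.2 1 h (interpolant c θ x)
            ∂(Measure.pi (jointLaw ν)))
          - c ^ 2 * (Real.sin θ * ∫ x, iterPartialDeriv i.2 2 h (interpolant c θ x)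
            ∂(Measure.pi (jointLaw ν))))) θ := by
  have hid : Integrable (fun t : ℝ => t) (gaussianReal 0 1) := by
    simpa using integrable_pow_gaussianReal 1
  obtain ⟨C, hC⟩ := hh.bounded 0 (by omega)
  have key := hasDerivAt_integral_linear_path (μ := jointLaw ν)
    (hh.differentiable_self (by omega)) (C := C) (fun w => by simpa using hC w)
    (e := direction)
    (N := Sum.elim (fun i => supNorm (iterPartialDeriv i.2 1 h))
      (fun j => supNorm (iterPartialDeriv j 1 h)))
    (by
      rintro (i | j) w
      · simp only [direction, Sum.elim_inl, ← hh.partialDeriv_eq_fderiv (by omega)]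
        exact hh.abs_iterPartialDeriv_le _ (by omega) w
      · simp only [direction, Sum.elim_inr, ← hh.partialDeriv_eq_fderiv (by omega)]
        exact hh.abs_iterPartialDeriv_le _ (by omega) w)
    (by
      rintro (i | j)
      · exact hν i
      · exact hid)
    (f := weight c) (f' := weightDeriv c) (K := |c| + 1)
    (by
      rintro (i | j) θ
      · exact (Real.hasDerivAt_sin θ).const_mul c
      · exact Real.hasDerivAt_cos θ)
    (by
      rintro (i | j) θ
      · simp only [weightDeriv, Sum.elim_inl, abs_mul]
        have := Real.abs_cos_le_one θ
        nlinarith [abs_nonneg c]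
      · simp only [weightDeriv, Sum.elim_inr, abs_neg]
        have := Real.abs_sin_le_one θ
        linarith [abs_nonneg c]) θ
  refine key.congr_deriv ?_
  rw [Fintype.sum_sum_type]
  simp only [direction, weightDeriv, Sum.elim_inl, Sum.elim_inr,
    ← hh.partialDeriv_eq_fderiv (show 0 < q + 2 by omega)]
  have hibp : ∀ j : Fin d, ∫ x, x (Sum.inr j) * iterPartialDeriv j 1 h (interpolant c θ x)
        ∂(Measure.pi (jointLaw ν))
      = Real.cos θ * ∫ x, iterPartialDeriv j 2 h (interpolant c θ x)
        ∂(Measure.pi (jointLaw ν)) := fun j => by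
    have := (hh.boundedDirDeriv j (show 1 < q + 2 by omega)).integral_eval_mul
      (μ := jointLaw ν) (a := Sum.inr j) rfl (v := fun i => weight c i θ • direction i)
      (b := Real.cos θ) rfl 0
    simpa only [zero_add, interpolant] using this
  change (∑ i : Fin n × Fin d, c * Real.cos θ * ∫ x, x (Sum.inl i)
        * iterPartialDeriv i.2 1 h (interpolant c θ x) ∂(Measure.pi (jointLaw ν)))
      + ∑ j : Fin d, -Real.sin θ * ∫ x, x (Sum.inr j)
        * iterPartialDeriv j 1 h (interpolant c θ x) ∂(Measure.pi (jointLaw ν)) = _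
  simp_rw [hibp, mul_sub]
  rw [Finset.sum_sub_distrib, sub_eq_add_neg]
  congr 1
  · exact Finset.sum_congr rfl fun i _ => by ring
  · rw [Fintype.sum_prod_type]
    simp only [Finset.sum_const, Finset.card_univ, Fintype.card_fin, nsmul_eq_mul]
    rw [Finset.mul_sum, ← Finset.sum_neg_distrib]
    refine Finset.sum_congr rfl fun j _ => ?_
    -- Here n c² = 1 distributes the Gaussian term equally among the n summands.
    linear_combination (Real.cos θ * (Real.sin θ * ∫ x, iterPartialDeriv j 2 h (interpolant c θ x)
        ∂(Measure.pi (jointLaw ν)))) * hc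

lemma abs_integral_interpolant_sub_le (hh : IsCb (q + 2) h)
    (hν : ∀ i, Integrable (fun x => |x| ^ (q + 2)) (ν i)) {c : ℝ} (hc0 : 0 ≤ c)
    (hc : n * c ^ 2 = 1) :
    |(∫ x, h (interpolant c (Real.pi / 2) x) ∂(Measure.pi (jointLaw ν)))
        - ∫ x, h (interpolant c 0 x) ∂(Measure.pi (jointLaw ν))|
      ≤ ∑ i : Fin n × Fin d, (c * |momentMismatch (ν i) id 1|
            * supNorm (iterPartialDeriv i.2 1 h)
        + (∑ k ∈ Finset.range q, c ^ (k + 2) / ((k + 1).factorial : ℝ) * M h i.2 (k + 1)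
            * |((k : ℝ) + 1) * momentMismatch (ν i) id k - momentMismatch (ν i) id (k + 2)|)
        + c ^ (q + 2) * M h i.2 (q + 1) * ((∫ x, |x| ^ q ∂(ν i)) / (q.factorial : ℝ)
            + (∫ x, |x| ^ (q + 2) ∂(ν i)) / ((q + 1).factorial : ℝ))) := by
  have hint : ∀ i, Integrable (fun t : ℝ => t) (ν i) := fun i => by
    simpa using integrable_pow_of_le (k := 1) (by omega) (hν i)
  have hderiv := fun θ => hasDerivAt_integral_interpolant (ν := ν) hh hint hc θ
  set φ := fun θ => ∫ x, h (interpolant c θ x) ∂(Measure.pi (jointLaw ν))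
  set A : Fin n × Fin d → ℝ := fun i =>
    c * |momentMismatch (ν i) id 1| * supNorm (iterPartialDeriv i.2 1 h)
  set B : Fin n × Fin d → ℕ → ℝ := fun i k =>
    |((k : ℝ) + 1) * momentMismatch (ν i) id k - momentMismatch (ν i) id (k + 2)|
  set R : Fin n × Fin d → ℝ := fun i => (∫ x, |x| ^ q ∂(ν i)) / (q.factorial : ℝ)
            + (∫ x, |x| ^ (q + 2) ∂(ν i)) / ((q + 1).factorial : ℝ)
  have hR : ∀ i, 0 ≤ R i := fun i => by
    have h1 : 0 ≤ ∫ x, |x| ^ q ∂(ν i) := integral_nonneg fun x => by positivity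
    have h2 : 0 ≤ ∫ x, |x| ^ (q + 2) ∂(ν i) := integral_nonneg fun x => by positivity
    positivity
  set T : Fin n × Fin d → ℝ → ℝ := fun i θ => Real.cos θ * A i
    + (∑ k ∈ Finset.range q, c ^ (k + 2) / ((k + 1).factorial : ℝ)
        * interpolationFactor h i.2 (k + 1) θ * B i k)
    + c ^ (q + 2) * interpolationFactor h i.2 (q + 1) θ * R i
  have hβ : ∀ (j : Fin d) k, Continuous (interpolationFactor h j k) :=
    fun j k => continuous_interpolationFactor j k
  have hTc : ∀ i, Continuous (T i) := fun i => by fun_prop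
  -- The open interval matters: cos θ is the weight of the Gaussian coordinate and must be positive.
  have hbound : ∀ θ ∈ Set.Ioo 0 (Real.pi / 2), |deriv φ θ| ≤ ∑ i, T i θ := by
    intro θ hθ
    rw [(hderiv θ).deriv]
    have hcos : 0 < Real.cos θ := Real.cos_pos_of_mem_Ioo ⟨by linarith [hθ.1, Real.pi_pos], hθ.2⟩
    have hsin : 0 ≤ Real.sin θ :=
      Real.sin_nonneg_of_nonneg_of_le_pi hθ.1.le (by linarith [hθ.2, Real.pi_pos])
    refine (Finset.abs_sum_le_sum_abs _ _).trans (Finset.sum_le_sum fun i _ => ?_)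
    rw [abs_mul, abs_of_pos hcos]
    exact abs_stein_coordinate_le (μ := jointLaw ν) (q := q)
      (D := fun k => iterPartialDeriv i.2 k h)
      (N := fun k => supNorm (iterPartialDeriv i.2 k h))
      (fun k hk => hh.boundedDirDeriv i.2 (by omega)) (a := Sum.inl i) (g := Sum.inr i.2)
      (by simp) rfl (hν i) (v := fun i => weight c i θ • direction i) hcos hc0 hsin rfl rfl
  have hpi : (0 : ℝ) ≤ Real.pi / 2 := by positivity
  have hcont : Continuous φ := continuous_iff_continuousAt.2 fun θ => (hderiv θ).continuousAt
  have hTi : Continuous fun θ => ∑ i, T i θ := by fun_prop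
  have hd : ∀ θ, HasDerivAt φ (deriv φ θ) θ := fun θ => (hderiv θ).differentiableAt.hasDerivAt
  -- Integrating the inequality for φ and -φ needs only a continuous majorant, not continuity of φ'.
  have hle : |φ (Real.pi / 2) - φ 0| ≤ ∫ θ in (0 : ℝ)..(Real.pi / 2), ∑ i, T i θ := by
    refine abs_le.2 ⟨?_, ?_⟩
    · have := intervalIntegral.sub_le_integral_of_hasDeriv_right_of_le hpi
        (g := fun θ => -φ θ) (g' := fun θ => -deriv φ θ) hcont.neg.continuousOn
        (fun θ _ => (hd θ).neg.hasDerivWithinAt) hTi.integrableOn_Icc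
        (fun θ hθ => (neg_le_abs _).trans (hbound θ hθ))
      linarith
    · exact intervalIntegral.sub_le_integral_of_hasDeriv_right_of_le hpi
        hcont.continuousOn (fun θ _ => (hd θ).hasDerivWithinAt) hTi.integrableOn_Icc
        (fun θ hθ => (le_abs_self _).trans (hbound θ hθ))
  refine hle.trans ?_
  rw [intervalIntegral.integral_finsetSum fun i _ => (hTc i).intervalIntegrable _ _]
  refine Finset.sum_le_sum fun i _ => ?_
  have hB : ∀ k, 0 ≤ B i k := fun k => abs_nonneg _
  have hcos : ∫ θ in (0 : ℝ)..(Real.pi / 2), Real.cos θ = 1 := by simp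
  rw [intervalIntegral.integral_add (Continuous.intervalIntegrable (by fun_prop) _ _)
      (Continuous.intervalIntegrable (by fun_prop) _ _),
    intervalIntegral.integral_add (Continuous.intervalIntegrable (by fun_prop) _ _)
      (Continuous.intervalIntegrable (by fun_prop) _ _),
    intervalIntegral.integral_finsetSum fun k _ =>
      Continuous.intervalIntegrable (by fun_prop) _ _]
  simp only [intervalIntegral.integral_mul_const, intervalIntegral.integral_const_mul, hcos,
    one_mul]
  refine add_le_add (add_le_add le_rfl (Finset.sum_le_sum fun k _ => ?_)) ?_
  · exact mul_le_mul_of_nonneg_right (mul_le_mul_of_nonneg_left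
      (integral_interpolationFactor_le _ _) (by positivity)) (hB k)
  · exact mul_le_mul_of_nonneg_right (mul_le_mul_of_nonneg_left
      (integral_interpolationFactor_le _ _) (by positivity)) (hR i)

lemma interpolant_zero (c : ℝ) (x : (Fin n × Fin d) ⊕ Fin d → ℝ) :
    interpolant c 0 x = WithLp.toLp 2 fun j => x (Sum.inr j) := by
  ext l
  simp [interpolant, weight, direction, Fintype.sum_sum_type, Pi.single_apply]

lemma interpolant_pi_div_two (c : ℝ) (x : (Fin n × Fin d) ⊕ Fin d → ℝ) :
    interpolant c (Real.pi / 2) x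
      = c • ∑ i, WithLp.toLp 2 fun j => x (Sum.inl (i, j)) := by
  ext l
  simp [interpolant, weight, direction, Fintype.sum_sum_type, Fintype.sum_prod_type,
    Pi.single_apply, Finset.mul_sum, mul_comm]

lemma integral_interpolant_zero (hh : Measurable h) (c : ℝ) :
    ∫ x, h (interpolant c 0 x) ∂(Measure.pi (jointLaw ν))
      = ∫ z, h z ∂(stdGaussian (EuclideanSpace ℝ (Fin d))) := by
  have hmp : MeasurePreserving (fun (x : (Fin n × Fin d) ⊕ Fin d → ℝ) j => x (Sum.inr j))
      (Measure.pi (jointLaw ν)) (Measure.pi fun _ => gaussianReal 0 1) :=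
    measurePreserving_snd.comp (measurePreserving_sumPiEquivProdPi (jointLaw ν))
  have hF : Measurable fun y : Fin d → ℝ => h (WithLp.toLp 2 y) := hh.comp (by fun_prop)
  simp_rw [interpolant_zero]
  rw [← map_pi_eq_stdGaussian, integral_map (by fun_prop) hh.aestronglyMeasurable, ← hmp.map_eq,
    integral_map hmp.measurable.aemeasurable hF.aestronglyMeasurable]

lemma integral_interpolant_pi_div_two {Ω : Type*} [MeasurableSpace Ω] {P : Measure Ω}
    [IsProbabilityMeasure P] {X : Fin n → Fin d → Ω → ℝ} (hX : ∀ i j, Measurable (X i j))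
    (hind : iIndepFun (fun (ij : Fin n × Fin d) => X ij.1 ij.2) P)
    (hν : ∀ i, ν i = P.map (X i.1 i.2)) (hh : Measurable h) :
    ∫ x, h (interpolant (1 / √n) (Real.pi / 2) x) ∂(Measure.pi (jointLaw ν))
      = ∫ ω, h (standardisedSum X ω) ∂P := by
  have hmp : MeasurePreserving (fun (x : (Fin n × Fin d) ⊕ Fin d → ℝ) i => x (Sum.inl i))
      (Measure.pi (jointLaw ν)) (Measure.pi ν) :=
    measurePreserving_fst.comp (measurePreserving_sumPiEquivProdPi (jointLaw ν))
  have hmap : P.map (fun ω (i : Fin n × Fin d) => X i.1 i.2 ω) = Measure.pi ν := by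
    rw [(iIndepFun_iff_map_fun_eq_pi_map fun i : Fin n × Fin d =>
      (hX i.1 i.2).aemeasurable).1 hind, funext hν]
  have hF : Measurable fun y : Fin n × Fin d → ℝ =>
      h ((1 / √n) • ∑ i, WithLp.toLp 2 fun j => y (i, j)) := hh.comp (by fun_prop)
  simp_rw [interpolant_pi_div_two]
  have h1 := integral_map hmp.measurable.aemeasurable
    (hF.aestronglyMeasurable (μ := (Measure.pi (jointLaw ν)).map _))
  have h2 := integral_map (μ := P) (φ := fun ω (i : Fin n × Fin d) => X i.1 i.2 ω)
    (measurable_pi_lambda _ fun i : Fin n × Fin d => hX i.1 i.2).aemeasurable hF.aestronglyMeasurable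
  rw [← h1, hmp.map_eq, ← hmap, h2]
  rfl

lemma momentMismatch_map {Ω : Type*} [MeasurableSpace Ω] {P : Measure Ω} {Y : Ω → ℝ}
    (hY : Measurable Y) (k : ℕ) : momentMismatch (P.map Y) id k = momentMismatch P Y k := by
  unfold momentMismatch
  rw [integral_map hY.aemeasurable (by fun_prop)]
  rfl

lemma sum_Icc_one_eq_sum_range (f : ℕ → ℝ) (q : ℕ) :
    ∑ k ∈ Finset.Icc 1 q, f k = ∑ k ∈ Finset.range q, f (k + 1) := by
  rw [Finset.range_eq_Ico, Finset.sum_Ico_add' f 0 q 1]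
  rfl

lemma one_div_sqrt_pow {x : ℝ} (hx : 0 ≤ x) (k : ℕ) :
    (1 / √x) ^ k = 1 / x ^ ((k : ℝ) / 2) := by
  rw [div_pow, one_pow, Real.sqrt_eq_rpow, ← Real.rpow_mul_natCast hx]
  ring_nf

end Interpolation

end MatchingMoments

theorem mainTheorem6 {Ω : Type*} [MeasurableSpace Ω] (P : Measure Ω) [IsProbabilityMeasure P]
    (n d p : ℕ) (hn : 1 ≤ n) (hp : 1 ≤ p)
    (X : Fin n → Fin d → Ω → ℝ)
    (hX_meas : ∀ i j, Measurable (X i j))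
    (hX_indep : iIndepFun (fun (ij : Fin n × Fin d) => X ij.1 ij.2) P)
    (hX_mom : ∀ i j, Integrable (fun ω => |X i j ω| ^ (p + 1)) P)
    (h : EuclideanSpace ℝ (Fin d) → ℝ) (hh : MatchingMoments.IsCb (p + 1) h) :
    |(∫ ω, h (MatchingMoments.standardisedSum X ω) ∂P)
        - ∫ z, h z ∂(stdGaussian (EuclideanSpace ℝ (Fin d)))|
      ≤ (∑ i, ∑ j, |MatchingMoments.momentMismatch P (X i j) 1| / Real.sqrt n
            * MatchingMoments.supNorm (MatchingMoments.partialDeriv j h))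
        + (∑ i, ∑ j, ∑ k ∈ Finset.Icc 1 (p - 1),
            MatchingMoments.M h j k / ((k.factorial : ℝ) * (n : ℝ) ^ (((k : ℝ) + 1) / 2))
              * |(k : ℝ) * MatchingMoments.momentMismatch P (X i j) (k - 1)
                  - MatchingMoments.momentMismatch P (X i j) (k + 1)|)
        + ∑ i, ∑ j, MatchingMoments.M h j p / (n : ℝ) ^ (((p : ℝ) + 1) / 2)
            * ((∫ ω, |X i j ω| ^ (p - 1) ∂P) / ((p - 1).factorial : ℝ)
                + (∫ ω, |X i j ω| ^ (p + 1) ∂P) / (p.factorial : ℝ)) := by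
  -- With p = q + 1, the exponents p - 1 and p + 1 become q and q + 2 without truncated subtraction.
  obtain ⟨q, rfl⟩ : ∃ q, p = q + 1 := ⟨p - 1, by omega⟩
  have hn0 : (0 : ℝ) < n := by exact_mod_cast hn
  have hmeas : Measurable h := (hh.differentiable_self (by omega)).continuous.measurable
  let ν : Fin n × Fin d → Measure ℝ := fun i => P.map (X i.1 i.2)
  have hprob : ∀ i, IsProbabilityMeasure (ν i) := fun i =>
    Measure.isProbabilityMeasure_map (hX_meas i.1 i.2).aemeasurable
  have habs : ∀ i j k, ∫ x, |x| ^ k ∂(ν (i, j)) = ∫ ω, |X i j ω| ^ k ∂P := fun i j k =>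
    integral_map (hX_meas i j).aemeasurable (by fun_prop)
  have hν : ∀ i, Integrable (fun x => |x| ^ (q + 2)) (ν i) := fun i =>
    (integrable_map_measure (by fun_prop) (hX_meas i.1 i.2).aemeasurable).2 (hX_mom i.1 i.2)
  have key := MatchingMoments.abs_integral_interpolant_sub_le (ν := ν) hh hν
    (c := 1 / √n) (by positivity) (by
      rw [div_pow, Real.sq_sqrt hn0.le]
      field_simp)
  rw [MatchingMoments.integral_interpolant_pi_div_two hX_meas hX_indep (fun _ => rfl) hmeas,
    MatchingMoments.integral_interpolant_zero hmeas] at key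
  refine key.trans (le_of_eq ?_)
  rw [Fintype.sum_prod_type]
  simp only [← Finset.sum_add_distrib]
  refine Finset.sum_congr rfl fun i _ => Finset.sum_congr rfl fun j _ => ?_
  rw [Nat.add_sub_cancel, MatchingMoments.sum_Icc_one_eq_sum_range, habs, habs]
  simp only [ν, MatchingMoments.momentMismatch_map (hX_meas i j),
    MatchingMoments.one_div_sqrt_pow hn0.le, Nat.add_sub_cancel]
  have hexp : ∀ k : ℕ, (((k + 2 : ℕ) : ℝ)) / 2 = (((k + 1 : ℕ) : ℝ) + 1) / 2 := fun k => by
    push_cast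
    ring
  simp only [hexp]
  congr 1
  · congr 1
    · rw [MatchingMoments.iterPartialDeriv_succ]
      simp only [MatchingMoments.iterPartialDeriv, Function.iterate_zero, id_eq]
      ring
    · refine Finset.sum_congr rfl fun k _ => ?_
      push_cast
      ring
  · ring
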